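/- Let $n\ge 1$, let $[n]=\{1,\dots,n\}$ and let $\mathfrak S_n$ be the set of permutations of $[n]$. Write $\chi(P)=1$ if $P$ holds and $\chi(P)=0$ otherwise. **Histories.** A 2-Motzkin path of length $n$ is a word $w=w_1\cdots w_n$ in the letters $\mathrm N$ (northeast step), $\mathrm S$ (southeast step), $\mathrm E$, $\mathrm{dE}$ (solid and dotted east step) whose lattice path goes from $(0,0)$ to $(n,0)$ and never goes below the horizontal axis. We say that $w_i$ is $\mathrm{NE}$ if $w_i\in\{\mathrm N,\mathrm E\}$, and $\mathrm{SdE}$ if $w_i\in\{\mathrm S,\mathrm{dE}\}$. Let $\mathfrak L_n$ be the set of triples $W=(w,h,c)$ where $w$ is a 2-Motzkin path of length $n$, $h_i=\#\{j<i: w_j=\mathrm N\}-\#\{j<i: w_j=\mathrm S\}$, and $c=(c_1,\dots,c_n)$ is an integer vector with $c_i\le h_i$, $c_i\ge 0$ if $w_i$ is $\mathrm{NE}$, and $c_i\ge 1$ if $w_i$ is $\mathrm{SdE}$. Put $\mathrm{cs}(W)=\max\{i: c_i=0\}$; this exists because $c_1=0$. **The involution $\xi$.** Consider involutions $\xi:\mathfrak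 L_n\to\mathfrak L_n$ such that for every $W=(w,h,c)\in\mathfrak L_n$, with $m=\mathrm{cs}(W)$ and $\xi(W)=(v,g,b)$: 1. $\mathrm{cs}(\xi(W))=n+1-m$; 2. for each $j\in[n]$ with $j\ne n+1-m$, $v_j$ is $\mathrm{NE}$ if and only if $w_{n+1-j}$ is $\mathrm{SdE}$; 3. for each $j\in[n]$, $g_j=h_{n+1-j}+1$ if $j>n+1-m$ and $v_j$ is $\mathrm{SdE}$; $g_j=h_{n+1-j}-1$ if $j<n+1-m$ and $v_j$ is $\mathrm{NE}$; and $g_j=h_{n+1-j}$ otherwise; 4. for each $j\in[n]$, $b_j=g_j-h_{n+1-j}+c_{n+1-j}$. **The map $\Phi_{\mathrm{FZ}}$.** For $\pi\in\mathfrak S_n$ let $\mathrm{Ep}(\pi)=\{i:\pi(i)>i\}$, and let $s_i=\#\{k<i: k\in\mathrm{Ep}(\pi),\ \pi(k)>\pi(i)\}$ if $i\in\mathrm{Ep}(\pi)$ and $s_i=\#\{k>i: k\notin\mathrm{Ep}(\pi),\ \pi(k)<\pi(i)\}$ otherwise. Let $\Phi_{\mathrm{FZ}}(\pi)=(w,h,c)$,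 where $w_i=\mathrm N$ if $\pi^{-1}(i)>i<\pi(i)$, $w_i=\mathrm S$ if $\pi^{-1}(i)<i>\pi(i)$, $w_i=\mathrm E$ if $\pi^{-1}(i)\ge i\ge\pi(i)$, $w_i=\mathrm{dE}$ if $\pi^{-1}(i)<i<\pi(i)$; $h$ is determined by $w$ as above; and $c_i=s_{\pi^{-1}(i)}+\chi(w_i\text{ is }\mathrm{SdE})$. **The map $\Phi_{\mathrm{YZL}}$.** Let $p=\pi^{-1}(1)$ and $\mathrm{nest}_i(\pi)=\#\{j: j<i<\pi(i)<\pi(j)\text{ or }\pi(j)<\pi(i)\le i<j\}$. Let $\mathrm{vnest}_i(\pi)$ be $\mathrm{nest}_i(\pi)-1$ if $\pi(i)\le i<p$, be $\mathrm{nest}_i(\pi)+1$ if $\pi(i)>i>p$, and be $\mathrm{nest}_i(\pi)$ otherwise. Let $\Phi_{\mathrm{YZL}}(\pi)=(w,h,c)$, where - for $i<n$ with $i\ne p$, $w_i$ is $\mathrm N$, $\mathrm E$, $\mathrm{dE}$ or $\mathrm S$ according as ($i<\pi(i)$ and $i+1\le\pi^{-1}(i+1)$), ($i<\pi(i)$ and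 $i+1>\pi^{-1}(i+1)$), ($i\ge\pi(i)$ and $i+1\le\pi^{-1}(i+1)$), or ($i\ge\pi(i)$ and $i+1>\pi^{-1}(i+1)$); - for $i=p<n$, $w_i=\mathrm N$ if $i+1\le\pi^{-1}(i+1)$ and $w_i=\mathrm E$ otherwise; - $w_n=\mathrm E$ if $p=n$ and $w_n=\mathrm S$ otherwise; - $h$ is determined by $w$ as above, and $c_i=\mathrm{vnest}_i(\pi)+\chi(w_i\text{ is }\mathrm{SdE})$. **Maps on permutations.** Let $\theta(\pi)$ be the permutation with $\theta(\pi)(n)=n+1-\pi(n)$ and $\theta(\pi)(i)=n+1-\pi(n-i)$ for $i<n$. Let $\pi^{\mathrm{rci}}$ be the reverse of the complement of the inverse of $\pi$, that is, $\pi^{\mathrm{rci}}(i)=n+1-\pi^{-1}(n+1-i)$. Let $\varkappa(\pi)=\pi^{-1}(2)\cdots\pi^{-1}(n)\,\pi^{-1}(1)$ in one-line notation (the Kreweras complement). **Theorem.** $\Phi_{\mathrm{FZ}}$ is a well-defined bijection from $\mathfrak S_n$ to $\mathfrak L_n$, $\Phi_{\mathrm{YZL}}$ is a well-defined map from $\mathfrak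 S_n$ to $\mathfrak L_n$, there is exactly one involution $\xi$ of $\mathfrak L_n$ as above, and for every $\pi\in\mathfrak S_n$ $$\Phi_{\mathrm{FZ}}^{-1}\circ\xi\circ\Phi_{\mathrm{FZ}}(\pi)=\theta(\pi),\qquad \Phi_{\mathrm{YZL}}(\pi)=\Phi_{\mathrm{FZ}}(\theta(\pi^{\mathrm{rci}}))=\Phi_{\mathrm{FZ}}(\varkappa(\pi)).$$ -/

import Mathlib

/-!
Conventions.  The set `[n] = {1, …, n}` is modelled by `Fin n` (the number `i` of `[n]` is the
element of `Fin n` with value `i - 1`), so permutations of `[n]` are `Equiv.Perm (Fin n)`, the map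
`i ↦ n + 1 - i` is `Fin.rev`, and `1` is `0 : Fin n`.  All comparisons below are invariant under
this shift.
-/

namespace SRLaguerre

/-- The four kinds of steps of a 2-Motzkin path: northeast, southeast, solid east, dotted east. -/
inductive Step where
  | N
  | S
  | E
  | dE
  deriving DecidableEq

/-- A step labelled `NE`: northeast or solid east. -/
def Step.IsNE (s : Step) : Prop := s = Step.N ∨ s = Step.E

/-- A step labelled `SdE`: southeast or dotted east. -/
def Step.IsSdE (s : Step) : Prop := s = Step.S ∨ s = Step.dE

instance (s : Step) : Decidable s.IsNE := inferInstanceAs (Decidable (_ ∨ _))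

instance (s : Step) : Decidable s.IsSdE := inferInstanceAs (Decidable (_ ∨ _))

/-- The ordinate reached by the path with steps `w` after its first `k` steps. -/
def ordinate {n : ℕ} (w : Fin n → Step) (k : ℕ) : ℤ :=
  ((Finset.univ.filter fun j : Fin n => j.val < k ∧ w j = Step.N).card : ℤ)
    - ((Finset.univ.filter fun j : Fin n => j.val < k ∧ w j = Step.S).card : ℤ)

/-- `w` is a 2-Motzkin path of length `n`: it starts at `(0,0)`, never goes below the horizontal
axis, and ends at `(n,0)`. -/
def IsTwoMotzkin {n : ℕ} (w : Fin n → Step) : Prop :=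
  (∀ k ≤ n, 0 ≤ ordinate w k) ∧ ordinate w n = 0

/-- The height of the `i`-th step: the number of `N` steps minus the number of `S` steps
strictly before it. -/
def stepHeight {n : ℕ} (w : Fin n → Step) (i : Fin n) : ℤ := ordinate w i.val

/-- Triples `(w, h, c)`: a word of steps, and vectors of heights and of weights. -/
@[ext]
structure Triple (n : ℕ) where
  w : Fin n → Step
  h : Fin n → ℤ
  c : Fin n → ℤ

/-- `(w, h, c)` is a (shifted and restricted) Laguerre history of length `n`. -/
structure IsHistory {n : ℕ} (W : Triple n) : Prop where
  path : IsTwoMotzkin W.w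
  height : ∀ i, W.h i = stepHeight W.w i
  weight_le : ∀ i, W.c i ≤ W.h i
  weight_ge_of_NE : ∀ i, (W.w i).IsNE → 0 ≤ W.c i
  weight_ge_of_SdE : ∀ i, (W.w i).IsSdE → 1 ≤ W.c i

/-- The set of shifted and restricted Laguerre histories of length `n`. -/
def History (n : ℕ) : Type := {W : Triple n // IsHistory W}

/-- The first step of a history has weight `0`. -/
theorem History.weight_zero {n : ℕ} [NeZero n] (W : History n) : W.1.c 0 = 0 := by
  have h0 : W.1.h 0 = 0 := by
    rw [W.2.height]
    simp [stepHeight, ordinate]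
  have hle := W.2.weight_le 0
  have h1 := W.2.weight_ge_of_NE 0
  have h2 := W.2.weight_ge_of_SdE 0
  rw [h0] at hle
  cases hw : W.1.w 0 <;> simp [hw, Step.IsNE, Step.IsSdE] at h1 h2 <;> omega

/-- The index of the critical step of `W`: the last step that has weight `0`. -/
def History.cs {n : ℕ} [NeZero n] (W : History n) : Fin n :=
  (Finset.univ.filter fun i : Fin n => W.1.c i = 0).max' ⟨0, by simp [W.weight_zero]⟩

/-- The four conditions that tie the image `V = (v, g, b)` of the reflection-like involution to
its argument `W = (w, h, c)`, where `m = cs W` and `m.rev` stands for `n + 1 - m`. -/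
structure IsReflection {n : ℕ} [NeZero n] (W V : History n) : Prop where
  critical : V.cs = W.cs.rev
  step : ∀ j, j ≠ W.cs.rev → ((V.1.w j).IsNE ↔ (W.1.w j.rev).IsSdE)
  height : ∀ j, V.1.h j =
    if W.cs.rev < j ∧ (V.1.w j).IsSdE then W.1.h j.rev + 1
    else if j < W.cs.rev ∧ (V.1.w j).IsNE then W.1.h j.rev - 1
    else W.1.h j.rev
  weight : ∀ j, V.1.c j = V.1.h j - W.1.h j.rev + W.1.c j.rev

/-- `ξ` is an involution on histories that satisfies the four conditions. -/
def IsXi {n : ℕ} [NeZero n] (ξ : History n → History n) : Prop :=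
  Function.Involutive ξ ∧ ∀ W, IsReflection W (ξ W)

variable {n : ℕ}

/-! ### The Foata–Zeilberger map -/

/-- `i` is an excedance position of `π`. -/
def IsEp (π : Equiv.Perm (Fin n)) (i : Fin n) : Prop := i < π i

/-- `i` is a cyclic valley of `π`. -/
def IsCval (π : Equiv.Perm (Fin n)) (i : Fin n) : Prop := i < π⁻¹ i ∧ i < π i

/-- `i` is a cyclic peak of `π`. -/
def IsCpk (π : Equiv.Perm (Fin n)) (i : Fin n) : Prop := π⁻¹ i < i ∧ π i < i

/-- `i` is a cyclic double descent of `π` (fixed points are included). -/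
def IsCdd (π : Equiv.Perm (Fin n)) (i : Fin n) : Prop := i ≤ π⁻¹ i ∧ π i ≤ i

/-- `i` is a cyclic double ascent of `π`. -/
def IsCda (π : Equiv.Perm (Fin n)) (i : Fin n) : Prop := π⁻¹ i < i ∧ i < π i

instance (π : Equiv.Perm (Fin n)) : DecidablePred (IsEp π) :=
  fun _ => inferInstanceAs (Decidable (_ < _))

instance (π : Equiv.Perm (Fin n)) : DecidablePred (IsCval π) :=
  fun _ => inferInstanceAs (Decidable (_ ∧ _))

instance (π : Equiv.Perm (Fin n)) : DecidablePred (IsCpk π) :=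
  fun _ => inferInstanceAs (Decidable (_ ∧ _))

instance (π : Equiv.Perm (Fin n)) : DecidablePred (IsCdd π) :=
  fun _ => inferInstanceAs (Decidable (_ ∧ _))

instance (π : Equiv.Perm (Fin n)) : DecidablePred (IsCda π) :=
  fun _ => inferInstanceAs (Decidable (_ ∧ _))

/-- Every index is of one of the four cyclic types. -/
theorem isCda_of_not (π : Equiv.Perm (Fin n)) (i : Fin n) (h1 : ¬ IsCval π i) (h2 : ¬ IsCpk π i)
    (h3 : ¬ IsCdd π i) : IsCda π i := by
  have key : π⁻¹ i = i ↔ π i = i := by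
    rw [Equiv.Perm.inv_eq_iff_eq, eq_comm]
  simp only [IsCval, IsCpk, IsCdd, IsCda, not_and, not_lt, not_le, Fin.lt_def, Fin.le_def,
    Fin.ext_iff] at *
  omega

/-- The side number `s i`: for an excedance position `i`, the number of excedance values to the
left of `π i` that are greater than `π i`; otherwise the number of non-excedance values to the
right of `π i` that are smaller than `π i`. -/
def sideNumber (π : Equiv.Perm (Fin n)) (i : Fin n) : ℕ :=
  if IsEp π i then (Finset.univ.filter fun k => k < i ∧ IsEp π k ∧ π i < π k).card
  else (Finset.univ.filter fun k => i < k ∧ ¬ IsEp π k ∧ π k < π i).card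

/-- The steps of the Foata–Zeilberger history of `π`.  In the last case `i` is a cyclic double
ascent. -/
def fzStep (π : Equiv.Perm (Fin n)) (i : Fin n) : Step :=
  if IsCval π i then Step.N
  else if IsCpk π i then Step.S
  else if IsCdd π i then Step.E
  else Step.dE

/-- The triple `(w, h, c)` that the (shifted) Foata–Zeilberger map attaches to `π`. -/
def fzTriple (π : Equiv.Perm (Fin n)) : Triple n where
  w := fzStep π
  h := stepHeight (fzStep π)
  c := fun i => (sideNumber π (π⁻¹ i) : ℤ) + if (fzStep π i).IsSdE then 1 else 0

/-! ### The variant Yan–Zhou–Lin map -/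

/-- The position of `1` in `π`. -/
def pone [NeZero n] (π : Equiv.Perm (Fin n)) : Fin n := π⁻¹ 0

/-- The number of nestings of `π` at `i`. -/
def nest (π : Equiv.Perm (Fin n)) (i : Fin n) : ℕ :=
  (Finset.univ.filter fun j =>
    (j < i ∧ i < π i ∧ π i < π j) ∨ (π j < π i ∧ π i ≤ i ∧ i < j)).card

/-- The shifted variant of the number of nestings of `π` at `i`. -/
def vnest [NeZero n] (π : Equiv.Perm (Fin n)) (i : Fin n) : ℤ :=
  if π i ≤ i ∧ i < pone π then (nest π i : ℤ) - 1
  else if i < π i ∧ pone π < i then (nest π i : ℤ) + 1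
  else (nest π i : ℤ)

/-- The step attached to an index `i` that is not the last one and is not the position of `1`,
where `j` is the index following `i`: shifted cyclic valleys, double ascents, double descents and
peaks give `N`, `E`, `dE` and `S`. -/
def shiftedStep (π : Equiv.Perm (Fin n)) (i j : Fin n) : Step :=
  if i < π i then (if j ≤ π⁻¹ j then Step.N else Step.E)
  else (if j ≤ π⁻¹ j then Step.dE else Step.S)

/-- The steps of the variant Yan–Zhou–Lin history of `π`. -/
def yzlStep [NeZero n] (π : Equiv.Perm (Fin n)) (i : Fin n) : Step :=
  if hi : i.val + 1 < n then
    if i = pone π then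
      if (⟨i.val + 1, hi⟩ : Fin n) ≤ π⁻¹ ⟨i.val + 1, hi⟩ then Step.N else Step.E
    else shiftedStep π i ⟨i.val + 1, hi⟩
  else if pone π = i then Step.E else Step.S

/-- The triple `(w, h, c)` that the variant Yan–Zhou–Lin map attaches to `π`. -/
def yzlTriple [NeZero n] (π : Equiv.Perm (Fin n)) : Triple n where
  w := yzlStep π
  h := stepHeight (yzlStep π)
  c := fun i => vnest π i + if (yzlStep π i).IsSdE then 1 else 0

/-! ### Maps on permutations -/

/-- The reverse of `π`. -/
def reversal (π : Equiv.Perm (Fin n)) : Equiv.Perm (Fin n) := π * Fin.revPerm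

/-- The complement of `π`. -/
def complement (π : Equiv.Perm (Fin n)) : Equiv.Perm (Fin n) := Fin.revPerm * π

/-- The permutation obtained by taking the inverse, then the complement, then the reverse. -/
def rci (π : Equiv.Perm (Fin n)) : Equiv.Perm (Fin n) := reversal (complement π⁻¹)

/-- The map `θ`, "almost" the reverse-complement; its one-line description is given by
`theta_last` and `theta_of_lt`. -/
def theta (π : Equiv.Perm (Fin n)) : Equiv.Perm (Fin n) :=
  Fin.revPerm * π * Fin.revPerm * finRotate n

/-- The Kreweras complement; its one-line description is given by `kreweras_last` and
`kreweras_of_lt`. -/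
def kreweras (π : Equiv.Perm (Fin n)) : Equiv.Perm (Fin n) := π⁻¹ * finRotate n

theorem finRotate_of_val_lt (i : Fin n) (hi : i.val + 1 < n) :
    finRotate n i = ⟨i.val + 1, hi⟩ := by
  obtain _ | m := n
  · exact i.elim0
  · exact finRotate_of_lt (by omega)

theorem finRotate_of_val_last [NeZero n] (i : Fin n) (hi : i.val + 1 = n) :
    finRotate n i = 0 := by
  obtain _ | m := n
  · exact i.elim0
  · have : i = Fin.last m := Fin.ext (by simpa using hi)
    rw [this]
    exact finRotate_last

/-- `θ(π)(n) = n + 1 - π(n)`. -/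
theorem theta_last (π : Equiv.Perm (Fin n)) (i : Fin n) (hi : i.val + 1 = n) :
    theta π i = (π i).rev := by
  have : NeZero n := ⟨by omega⟩
  have h0 : (0 : Fin n).rev = i := Fin.ext (by simp [Fin.val_rev]; omega)
  simp [theta, finRotate_of_val_last i hi, h0]

/-- `θ(π)(i) = n + 1 - π(n - i)` for `i < n`. -/
theorem theta_of_lt (π : Equiv.Perm (Fin n)) (i : Fin n) (hi : i.val + 1 < n) :
    theta π i = (π ⟨n - 2 - i.val, by omega⟩).rev := by
  have h0 : (⟨i.val + 1, hi⟩ : Fin n).rev = ⟨n - 2 - i.val, by omega⟩ :=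
    Fin.ext (by simp [Fin.val_rev]; omega)
  simp [theta, finRotate_of_val_lt i hi, h0]

/-- The last letter of the Kreweras complement is `π⁻¹(1)`. -/
theorem kreweras_last [NeZero n] (π : Equiv.Perm (Fin n)) (i : Fin n) (hi : i.val + 1 = n) :
    kreweras π i = π⁻¹ 0 := by
  simp [kreweras, finRotate_of_val_last i hi]

/-- The `i`-th letter of the Kreweras complement is `π⁻¹(i + 1)` for `i < n`. -/
theorem kreweras_of_lt (π : Equiv.Perm (Fin n)) (i : Fin n) (hi : i.val + 1 < n) :
    kreweras π i = π⁻¹ ⟨i.val + 1, hi⟩ := by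
  simp [kreweras, finRotate_of_val_lt i hi]

end SRLaguerre

namespace SRLaguerre

open Finset OrderDual

variable {n : ℕ}

/-! ### Counting lemmas -/

/-! View an excedance of π as an arc from the position `k` to the larger value `π k`. In the word of
`fzStep π` the openers (`N`, `dE`) are the excedance positions and the `SdE` indices are the
excedance values, so the height at `i` counts the arcs with `j < i ≤ π j` (`ordinate_fzStep`).

The inverse of Φ_FZ is greedy. Going up through the `SdE` indices, `c i - 1` is the number of
smaller elements among the openers below `i` that are still free when `π⁻¹ i` is chosen; going down
through the `NE` indices, `c i` is the number of larger elements among the free non-openers from `i`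
on. The free elements number `h i` and `h i + 1` respectively, so `c i ≤ h i` says exactly that the
choice is possible. `IsRankCode.eqOn` then gives injectivity and `exists_isRankCode` surjectivity.

The conditions on ξ determine `ξ W` from `W` (`IsReflection.unique`): the critical step of the image
has weight 0 and so is `NE`, the other labels are prescribed, labels give heights and weights, and
heights with labels give the steps. For existence, θ is transported through Φ_FZ. Here the critical
index is the last letter of π (`cs_fzHistory`). Passing from `i` to `i.rev`, height and weight
receive the same correction: minus 1 if the step at `i` is `SdE`, plus 1 if `i` is less than the
last letter.

Finally `kreweras π` places the value `i` at position `π i - 1`, cyclically. Weak inequalities for π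
thus become strict ones for its Kreweras complement, and only the position of 1 wraps around, which
is what the corrections in `vnest` record (`yzlTriple_eq`). -/

theorem card_filter_comp_perm (e : Equiv.Perm (Fin n)) (P : Fin n → Prop) [DecidablePred P] :
    #{k | P (e k)} = #{k | P k} :=
  Finset.card_equiv e (by simp)

/-- Isolates the one index, such as the last position or the position of 1, at which two otherwise
equal counts may differ. -/
theorem card_filter_split (P : Fin n → Prop) [DecidablePred P] (a : Fin n) :
    #{k | P k} = #{k | P k ∧ k ≠ a} + if P a then 1 else 0 := by
  have h := Finset.card_filter_add_card_filter_not (s := univ.filter P) (fun k => k ≠ a)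
  rw [filter_filter, filter_filter] at h
  rw [← h]
  congr 1
  split_ifs with ha
  · rw [card_eq_one]
    exact ⟨a, by ext k; simp; rintro rfl; exact ha⟩
  · rw [card_eq_zero, filter_eq_empty_iff]
    rintro k - ⟨hk, hka⟩
    exact ha (not_not.1 hka ▸ hk)

theorem inv_apply_self (π : Equiv.Perm (Fin n)) (i : Fin n) : π⁻¹ (π i) = i :=
  π.symm_apply_apply i

theorem apply_inv_self (π : Equiv.Perm (Fin n)) (i : Fin n) : π (π⁻¹ i) = i :=
  π.apply_symm_apply i

/-! ### Steps and ordinates -/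

theorem Step.isSdE_iff_not_isNE (s : Step) : s.IsSdE ↔ ¬ s.IsNE := by
  cases s <;> simp [Step.IsNE, Step.IsSdE]

/-- The steps that the Foata–Zeilberger map assigns to excedance positions. -/
def Step.IsOpener (s : Step) : Prop := s = Step.N ∨ s = Step.dE

instance (s : Step) : Decidable s.IsOpener := inferInstanceAs (Decidable (_ ∨ _))

/-- Dotted east steps are both openers and `SdE`, so they cancel: the ordinate is arcs opened minus
arcs closed. -/
theorem ordinate_add_card_isSdE (w : Fin n → Step) (k : ℕ) :
    ordinate w k + #{j : Fin n | j.val < k ∧ (w j).IsSdE} =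
      #{j : Fin n | j.val < k ∧ (w j).IsOpener} := by
  have h1 : #{j : Fin n | j.val < k ∧ (w j).IsSdE} =
      #{j : Fin n | j.val < k ∧ w j = .S} + #{j : Fin n | j.val < k ∧ w j = .dE} := by
    rw [← card_union_of_disjoint]
    · congr 1; ext j; simp only [mem_union, mem_filter_univ]; rw [Step.IsSdE]; tauto
    · rw [disjoint_filter]; rintro j - ⟨-, h⟩ ⟨-, h'⟩; simp [h] at h'
  have h2 : #{j : Fin n | j.val < k ∧ (w j).IsOpener} =
      #{j : Fin n | j.val < k ∧ w j = .N} + #{j : Fin n | j.val < k ∧ w j = .dE} := by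
    rw [← card_union_of_disjoint]
    · congr 1; ext j; simp only [mem_union, mem_filter_univ]; rw [Step.IsOpener]; tauto
    · rw [disjoint_filter]; rintro j - ⟨-, h⟩ ⟨-, h'⟩; simp [h] at h'
  rw [ordinate, h1, h2]
  push_cast
  ring

theorem card_lt_add_card_ge (P : Fin n → Prop) [DecidablePred P] (k : ℕ) :
    #{j : Fin n | j.val < k ∧ P j} + #{j : Fin n | k ≤ j.val ∧ P j} = #{j | P j} := by
  rw [← Finset.card_filter_add_card_filter_not (s := univ.filter P) (fun j => j.val < k)]
  simp only [filter_filter, not_lt, and_comm]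

theorem card_ge_add_card_ge_not (P : Fin n → Prop) [DecidablePred P] (k : ℕ) :
    #{j : Fin n | k ≤ j.val ∧ P j} + #{j : Fin n | k ≤ j.val ∧ ¬ P j} =
      #{j : Fin n | k ≤ j.val} := by
  rw [← Finset.card_filter_add_card_filter_not (s := univ.filter fun j : Fin n => k ≤ j.val) P]
  simp only [filter_filter]

/-- The ordinate of a path that ends on the axis, computed from the right. -/
theorem ordinate_add_card_isNE {w : Fin n → Step} (hw : ordinate w n = 0) (k : ℕ) :
    ordinate w k + #{j : Fin n | k ≤ j.val ∧ (w j).IsNE} =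
      #{j : Fin n | k ≤ j.val ∧ ¬ (w j).IsOpener} := by
  have h1 := ordinate_add_card_isSdE w k
  have h2 := ordinate_add_card_isSdE w n
  have h3 := card_lt_add_card_ge (fun j => (w j).IsSdE) k
  have h4 := card_lt_add_card_ge (fun j => (w j).IsOpener) k
  have h5 := card_ge_add_card_ge_not (fun j => (w j).IsSdE) k
  have h6 := card_ge_add_card_ge_not (fun j => (w j).IsOpener) k
  simp only [Fin.is_lt, true_and] at h2
  have h7 : #{j : Fin n | k ≤ j.val ∧ (w j).IsNE} = #{j : Fin n | k ≤ j.val ∧ ¬ (w j).IsSdE} := by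
    simp only [Step.isSdE_iff_not_isNE, not_not]
  omega

theorem ordinate_succ (w : Fin n → Step) (i : Fin n) :
    ordinate w (i.val + 1) =
      ordinate w i.val + (if w i = .N then 1 else 0) - (if w i = .S then 1 else 0) := by
  have key : ∀ s : Step, #{j : Fin n | j.val < i.val + 1 ∧ w j = s} =
      #{j : Fin n | j.val < i.val ∧ w j = s} + if w i = s then 1 else 0 := by
    intro s
    rw [card_filter_split _ i]
    congr 1
    · congr 1; ext j; simp only [mem_filter_univ]; grind
    · simp
  rw [ordinate, ordinate, key, key]
  push_cast
  ring

/-! ### The steps of the Foata–Zeilberger history -/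

theorem isSdE_fzStep (π : Equiv.Perm (Fin n)) (i : Fin n) :
    (fzStep π i).IsSdE ↔ π⁻¹ i < i := by
  unfold fzStep
  split_ifs with h1 h2 h3 <;> simp [Step.IsSdE]
  · exact h1.1.le
  · exact h2.1
  · exact h3.1
  · exact (isCda_of_not π i h1 h2 h3).1

theorem isNE_fzStep (π : Equiv.Perm (Fin n)) (i : Fin n) :
    (fzStep π i).IsNE ↔ i ≤ π⁻¹ i := by
  rw [← not_lt, ← isSdE_fzStep, Step.isSdE_iff_not_isNE, not_not]

theorem isOpener_fzStep (π : Equiv.Perm (Fin n)) (i : Fin n) :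
    (fzStep π i).IsOpener ↔ IsEp π i := by
  unfold fzStep
  split_ifs with h1 h2 h3 <;> simp [Step.IsOpener, IsEp]
  · exact h1.2
  · exact h2.2.le
  · exact h3.2
  · exact (isCda_of_not π i h1 h2 h3).2

theorem Step.eq_of_iff {s t : Step} (h1 : s.IsSdE ↔ t.IsSdE) (h2 : s.IsOpener ↔ t.IsOpener) :
    s = t := by
  cases s <;> cases t <;> simp [Step.IsSdE, Step.IsOpener] at h1 h2 ⊢

/-- An excedance whose value is below `k` also starts below `k`; removing these from the arcs opened
before `k` leaves the arcs across `k`. -/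
theorem ordinate_fzStep (π : Equiv.Perm (Fin n)) (k : ℕ) :
    ordinate (fzStep π) k = #{j : Fin n | j.val < k ∧ k ≤ (π j).val} := by
  have h := ordinate_add_card_isSdE (fzStep π) k
  simp only [isSdE_fzStep, isOpener_fzStep, IsEp] at h
  rw [← card_filter_comp_perm π] at h
  simp only [inv_apply_self] at h
  have h2 := Finset.card_filter_add_card_filter_not
    (s := univ.filter fun j : Fin n => j.val < k ∧ j < π j) (fun j => (π j).val < k)
  simp only [filter_filter] at h2
  have h3 : #{j : Fin n | (j.val < k ∧ j < π j) ∧ (π j).val < k} =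
      #{j : Fin n | (π j).val < k ∧ j < π j} := by
    congr 1; ext j; simp only [mem_filter_univ]; omega
  have h4 : #{j : Fin n | (j.val < k ∧ j < π j) ∧ ¬ (π j).val < k} =
      #{j : Fin n | j.val < k ∧ k ≤ (π j).val} := by
    congr 1; ext j; simp only [mem_filter_univ]; omega
  omega

/-- As many positions as values lie below `k`, so the arcs crossing upward balance those crossing
downward. -/
theorem card_crossing (π : Equiv.Perm (Fin n)) (k : ℕ) :
    #{j : Fin n | j.val < k ∧ k ≤ (π j).val} = #{j : Fin n | (π j).val < k ∧ k ≤ j.val} := by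
  have h1 := card_filter_comp_perm π (fun j => j.val < k)
  have h2 := card_lt_add_card_ge (fun j : Fin n => (π j).val < k) k
  have h3 := Finset.card_filter_add_card_filter_not
    (s := univ.filter fun j : Fin n => j.val < k) (fun j => (π j).val < k)
  simp only [filter_filter, not_lt] at h3
  simp only [and_comm (a := k ≤ _)] at h2
  omega

theorem stepHeight_fzStep (π : Equiv.Perm (Fin n)) (i : Fin n) :
    stepHeight (fzStep π) i = #{j | j < i ∧ i ≤ π j} := ordinate_fzStep π i

theorem stepHeight_fzStep' (π : Equiv.Perm (Fin n)) (i : Fin n) :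
    stepHeight (fzStep π) i = #{j | π j < i ∧ i ≤ j} := by
  rw [stepHeight, ordinate_fzStep, card_crossing]
  rfl

theorem isHistory_fzTriple (π : Equiv.Perm (Fin n)) : IsHistory (fzTriple π) where
  path := by
    refine ⟨fun k _ => ?_, ?_⟩
    · simp only [fzTriple, ordinate_fzStep]; positivity
    · simp only [fzTriple, ordinate_fzStep]
      simp
  height _ := rfl
  weight_le i := by
    simp only [fzTriple, isSdE_fzStep]
    split_ifs with h
    · rw [stepHeight_fzStep, sideNumber, if_pos (by simpa [IsEp] using h)]
      -- The arc ending at `i` itself counts in the height but not in the side number; it absorbs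
      -- the shift by 1.
      rw [card_filter_split (fun j => j < i ∧ i ≤ π j) (π⁻¹ i), if_pos (by simpa using h)]
      refine add_le_add (Nat.cast_le.2 (card_le_card (monotone_filter_right _ ?_))) le_rfl
      rintro k - ⟨hk, hk', hk''⟩
      simp at hk''
      exact ⟨⟨hk.trans h, hk''.le⟩, hk.ne⟩
    · rw [stepHeight_fzStep', sideNumber, if_neg (by simpa [IsEp] using h), add_zero]
      refine Nat.cast_le.2 (card_le_card (monotone_filter_right _ ?_))
      rintro k - ⟨hk, hk', hk''⟩
      simp at hk''
      exact ⟨hk'', (not_lt.1 h).trans hk.le⟩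
  weight_ge_of_NE i _ := by
    simp only [fzTriple]; split_ifs <;> positivity
  weight_ge_of_SdE i h := by
    simp only [fzTriple] at h ⊢
    rw [if_pos h]; simp

/-! ### Rank codes -/

section RankCode

variable {α β : Type*} [LinearOrder α] [LinearOrder β]

/-- The map `f` picks, for the elements `b` of `B` in increasing order, the element of `A b` that
has exactly `r b` smaller ones among those elements of `A b` that have not been picked before. -/
def IsRankCode (B : Set α) (A : α → Set β) (r : α → ℕ) (f : α → β) : Prop :=
  ∀ b ∈ B, f b ∈ A b ∧ (∀ b' ∈ B, b' < b → f b' ≠ f b) ∧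
    {a | a ∈ A b ∧ (∀ b' ∈ B, b' < b → f b' ≠ a) ∧ a < f b}.ncard = r b

theorem exists_ncard_lt_eq {S : Set β} (hS : S.Finite) {r : ℕ} (hr : r < S.ncard) :
    ∃ x ∈ S, {a | a ∈ S ∧ a < x}.ncard = r := by
  obtain ⟨S, rfl⟩ := hS.exists_finset_coe
  rw [Set.ncard_coe_finset] at hr
  induction S using Finset.induction_on_max with
  | empty => simp at hr
  | insert a s hs ih =>
    have ha : a ∉ s := fun h => (hs a h).false
    rw [Finset.card_insert_of_notMem ha] at hr
    rcases (Nat.lt_succ_iff.1 hr).lt_or_eq with h | h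
    · obtain ⟨x, hx, hxr⟩ := ih s.finite_toSet h
      refine ⟨x, by simp at hx ⊢; exact Or.inr hx, ?_⟩
      rw [← hxr]
      congr 1
      ext y
      simp only [Finset.coe_insert, Set.mem_insert_iff, Finset.mem_coe, Set.mem_ofPred_eq]
      refine ⟨?_, fun h => ⟨Or.inr h.1, h.2⟩⟩
      rintro ⟨rfl | hy, hyx⟩
      · exact absurd hyx (hs x hx).asymm
      · exact ⟨hy, hyx⟩
    · refine ⟨a, by simp, ?_⟩
      rw [h, ← Set.ncard_coe_finset]
      congr 1
      ext y
      simp only [Finset.coe_insert, Set.mem_insert_iff, Finset.mem_coe, Set.mem_ofPred_eq]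
      refine ⟨?_, fun h => ⟨Or.inr h, hs y h⟩⟩
      rintro ⟨rfl | hy, hyx⟩
      · exact absurd hyx (lt_irrefl _)
      · exact hy

theorem eq_of_ncard_lt_eq {S : Set β} (hS : S.Finite) {x y : β} (hx : x ∈ S) (hy : y ∈ S)
    (h : {a | a ∈ S ∧ a < x}.ncard = {a | a ∈ S ∧ a < y}.ncard) : x = y := by
  have key : ∀ {x y : β}, x ∈ S → x < y →
      {a | a ∈ S ∧ a < x}.ncard < {a | a ∈ S ∧ a < y}.ncard := by
    intro x y hx hxy
    refine Set.ncard_lt_ncard ⟨fun a ha => ⟨ha.1, ha.2.trans hxy⟩, fun hsub => ?_⟩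
      (hS.subset fun a ha => ha.1)
    exact (hsub (a := x) ⟨hx, hxy⟩).2.false
  rcases lt_trichotomy x y with hlt | heq | hlt
  · exact absurd h (key hx hlt).ne
  · exact heq
  · exact absurd h (key hy hlt).ne'

/-- If the earlier choices agree, the same elements remain free, and an element of a finite chain is
determined by its rank. -/
theorem IsRankCode.eqOn [WellFoundedLT α] [Finite β] {B : Set α} {A : α → Set β} {r : α → ℕ}
    {f g : α → β} (hf : IsRankCode B A r f) (hg : IsRankCode B A r g) : Set.EqOn f g B := by
  intro b
  induction b using WellFoundedLT.induction with
  | ind b ih =>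
  intro hb
  obtain ⟨hf1, hf2, hf3⟩ := hf b hb
  obtain ⟨hg1, hg2, hg3⟩ := hg b hb
  have hset : ∀ a, (∀ b' ∈ B, b' < b → f b' ≠ a) ↔ (∀ b' ∈ B, b' < b → g b' ≠ a) := fun a =>
    forall₃_congr fun b' hb' hlt => by rw [ih b' hlt hb']
  refine eq_of_ncard_lt_eq (S := {a | a ∈ A b ∧ ∀ b' ∈ B, b' < b → g b' ≠ a}) (Set.toFinite _)
    ⟨hf1, (hset _).1 hf2⟩ ⟨hg1, hg2⟩ ?_
  simp only [Set.mem_ofPred_eq, and_assoc]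
  rw [hg3, ← hf3]
  simp only [hset]

/-- Greedy choice: earlier elements of `B` use up at most as many members of `A b` as there are such
elements, so one of rank `r b` is still free. -/
theorem exists_isRankCode [Finite β] [Nonempty β] (B : Finset α) (A : α → Set β) (r : α → ℕ)
    (hr : ∀ b ∈ B, {b' | b' ∈ B ∧ b' < b}.ncard + r b < (A b).ncard) :
    ∃ f, IsRankCode (B : Set α) A r f := by
  induction B using Finset.induction_on_max with
  | empty => exact ⟨fun _ => Classical.arbitrary β, by simp [IsRankCode]⟩
  | insert a s hs ih =>
    have ha : a ∉ s := fun h => (hs a h).false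
    have hlt : ∀ b ∈ s, ∀ b', (b' ∈ insert a s ∧ b' < b) ↔ (b' ∈ s ∧ b' < b) := by
      intro b hb b'
      rw [Finset.mem_insert]
      refine ⟨?_, fun h => ⟨Or.inr h.1, h.2⟩⟩
      rintro ⟨rfl | h, h'⟩
      · exact absurd h' (hs b hb).asymm
      · exact ⟨h, h'⟩
    have hlta : ∀ b', (b' ∈ insert a s ∧ b' < a) ↔ b' ∈ s := by
      intro b'
      rw [Finset.mem_insert]
      refine ⟨?_, fun h => ⟨Or.inr h, hs _ h⟩⟩
      rintro ⟨rfl | h, h'⟩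
      · exact absurd h' (lt_irrefl _)
      · exact h
    obtain ⟨f, hf⟩ := ih fun b hb => by
      have := hr b (Finset.mem_insert_of_mem hb)
      simpa only [hlt b hb] using this
    have hra := hr a (Finset.mem_insert_self a s)
    simp only [hlta] at hra
    have hcard : r a < (A a \ f '' (s : Set α)).ncard := by
      have h1 := Set.ncard_image_le (f := f) s.finite_toSet
      have h2 := Set.le_ncard_sdiff (f '' (s : Set α)) (A a) (s.finite_toSet.image f)
      have h3 : {b' | b' ∈ s}.ncard = (s : Set α).ncard := rfl
      omega
    obtain ⟨x, ⟨hxA, hxf⟩, hxr⟩ := exists_ncard_lt_eq (Set.toFinite _) hcard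
    have hup : ∀ b ∈ s, Function.update f a x b = f b := fun b hb =>
      Function.update_of_ne (ne_of_mem_of_not_mem hb ha) _ _
    refine ⟨Function.update f a x, fun b hb => ?_⟩
    rcases Finset.mem_insert.1 hb with rfl | hb
    · have hall : ∀ y, (∀ b' ∈ ((insert b s : Finset α) : Set α), b' < b →
          Function.update f b x b' ≠ y) ↔ y ∉ f '' (s : Set α) := by
        intro y
        simp only [Set.mem_image, Finset.mem_coe, not_exists, not_and]
        refine forall_congr' fun b' => ?_
        rw [← and_imp, hlta]
        exact forall_congr' fun hb' => by rw [hup b' hb']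
      rw [Function.update_self]
      refine ⟨hxA, (hall x).2 hxf, ?_⟩
      rw [← hxr]
      simp only [hall, Set.mem_sdiff, and_assoc]
    · obtain ⟨h1, h2, h3⟩ := hf b hb
      rw [hup b hb]
      have hall : ∀ y, (∀ b' ∈ ((insert a s : Finset α) : Set α), b' < b →
          Function.update f a x b' ≠ y) ↔ (∀ b' ∈ (s : Set α), b' < b → f b' ≠ y) := by
        intro y
        simp only [Finset.mem_coe]
        refine forall_congr' fun b' => ?_
        rw [← and_imp, hlt b hb, and_imp]
        exact forall_congr' fun hb' => by rw [hup b' hb']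
      refine ⟨h1, (hall _).2 h2, ?_⟩
      simpa only [hall] using h3

theorem IsRankCode.injOn {B : Set α} {A : α → Set β} {r : α → ℕ} {f : α → β}
    (hf : IsRankCode B A r f) : Set.InjOn f B := by
  intro x hx y hy hxy
  rcases lt_trichotomy x y with h | h | h
  · exact absurd hxy ((hf y hy).2.1 x hx h)
  · exact h
  · exact absurd hxy.symm ((hf x hx).2.1 y hy h)

end RankCode

/-! ### Bijectivity of the Foata–Zeilberger map -/

/-- The inverse of `π` picks the positions of the excedance values, in increasing order. -/
def IsUpperCode (w : Fin n → Step) (r : Fin n → ℕ) (σ : Fin n → Fin n) : Prop :=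
  IsRankCode {i | (w i).IsSdE} (fun i => {k | k < i ∧ (w k).IsOpener}) r σ

/-- The inverse of `π` picks the positions of the other values, in decreasing order. -/
def IsLowerCode (w : Fin n → Step) (r : Fin n → ℕ) (σ : Fin n → Fin n) : Prop :=
  IsRankCode (α := (Fin n)ᵒᵈ) (β := (Fin n)ᵒᵈ) {i | (w (ofDual i)).IsNE}
    (fun i => {k | ofDual i ≤ ofDual k ∧ ¬ (w (ofDual k)).IsOpener}) r σ

theorem isLowerCode_iff (w : Fin n → Step) (r : Fin n → ℕ) (σ : Fin n → Fin n) :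
    IsLowerCode w r σ ↔ ∀ b, (w b).IsNE → (b ≤ σ b ∧ ¬ (w (σ b)).IsOpener) ∧
      (∀ b', (w b').IsNE → b < b' → σ b' ≠ σ b) ∧
      {a | (b ≤ a ∧ ¬ (w a).IsOpener) ∧ (∀ b', (w b').IsNE → b < b' → σ b' ≠ a) ∧
        σ b < a}.ncard = r b := Iff.rfl

theorem isUpperCode_iff (w : Fin n → Step) (r : Fin n → ℕ) (σ : Fin n → Fin n) :
    IsUpperCode w r σ ↔ ∀ b, (w b).IsSdE → (σ b < b ∧ (w (σ b)).IsOpener) ∧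
      (∀ b', (w b').IsSdE → b' < b → σ b' ≠ σ b) ∧
      {a | (a < b ∧ (w a).IsOpener) ∧ (∀ b', (w b').IsSdE → b' < b → σ b' ≠ a) ∧
        a < σ b}.ncard = r b := Iff.rfl

/-- An excedance position `a` is still free at stage `b` exactly when its value `π a` is at least
`b`, so the free positions left of `π⁻¹ b` are those counted by the side number. -/
theorem isUpperCode_inv (π : Equiv.Perm (Fin n)) :
    IsUpperCode (fzStep π) (fun i => sideNumber π (π⁻¹ i)) ⇑π⁻¹ := by
  rw [isUpperCode_iff]
  intro b hb
  simp only [isSdE_fzStep, isOpener_fzStep, IsEp, apply_inv_self] at hb ⊢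
  refine ⟨⟨hb, hb⟩, fun b' _ h => (π⁻¹).injective.ne h.ne, ?_⟩
  rw [sideNumber, if_pos (by simpa [IsEp] using hb), ← Set.ncard_coe_finset]
  congr 1
  ext a
  simp only [Set.mem_ofPred_eq, coe_filter, mem_univ, true_and, apply_inv_self, IsEp]
  constructor
  · rintro ⟨⟨-, h1⟩, h2, h3⟩
    refine ⟨h3, h1, lt_of_le_of_ne (not_lt.1 fun h => ?_) fun h => ?_⟩
    · exact h2 (π a) (by rwa [inv_apply_self]) h (inv_apply_self _ _)
    · rw [h, inv_apply_self] at h3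
      exact h3.false
  · rintro ⟨h1, h2, h3⟩
    refine ⟨⟨h1.trans hb, h2⟩, ?_, h1⟩
    rintro b' - h rfl
    rw [apply_inv_self] at h3
    exact h3.asymm h

theorem isLowerCode_inv (π : Equiv.Perm (Fin n)) :
    IsLowerCode (fzStep π) (fun i => sideNumber π (π⁻¹ i)) ⇑π⁻¹ := by
  rw [isLowerCode_iff]
  intro b hb
  simp only [isNE_fzStep, isOpener_fzStep, IsEp, apply_inv_self, not_lt] at hb ⊢
  refine ⟨⟨hb, hb⟩, fun b' _ h => (π⁻¹).injective.ne h.ne', ?_⟩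
  rw [sideNumber, if_neg (by simpa [IsEp] using hb), ← Set.ncard_coe_finset]
  congr 1
  ext a
  simp only [Set.mem_ofPred_eq, coe_filter, mem_univ, true_and, apply_inv_self, IsEp, not_lt]
  constructor
  · rintro ⟨⟨-, h1⟩, h2, h3⟩
    refine ⟨h3, h1, lt_of_le_of_ne (not_lt.1 fun h => ?_) fun h => ?_⟩
    · exact h2 (π a) (by rwa [inv_apply_self]) h (inv_apply_self _ _)
    · rw [← h, inv_apply_self] at h3
      exact h3.false
  · rintro ⟨h1, h2, h3⟩
    refine ⟨⟨hb.trans h1.le, h2⟩, ?_, h1⟩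
    rintro b' - h rfl
    rw [apply_inv_self] at h3
    exact h3.asymm h

/-- The map `Φ_FZ`. -/
def fzHistory (π : Equiv.Perm (Fin n)) : History n := ⟨fzTriple π, isHistory_fzTriple π⟩

theorem fzHistory_injective : Function.Injective (fzHistory (n := n)) := by
  intro π π' h
  have ht : fzTriple π = fzTriple π' := congrArg Subtype.val h
  have hw : fzStep π = fzStep π' := congrArg Triple.w ht
  have hc : (fun i => sideNumber π (π⁻¹ i)) = fun i => sideNumber π' (π'⁻¹ i) := by
    funext i
    have := congrFun (congrArg Triple.c ht) i
    simp only [fzTriple, hw] at this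
    exact_mod_cast add_right_cancel this
  have hu := isUpperCode_inv π
  have hl := isLowerCode_inv π
  rw [hw, hc] at hu hl
  have hu' := IsRankCode.eqOn hu (isUpperCode_inv π')
  have hl' := IsRankCode.eqOn (α := (Fin n)ᵒᵈ) (β := (Fin n)ᵒᵈ) hl (isLowerCode_inv π')
  refine inv_injective (Equiv.ext fun i => ?_)
  by_cases hi : (fzStep π' i).IsNE
  · exact hl' hi
  · exact hu' ((Step.isSdE_iff_not_isNE _).2 hi)

theorem ncard_setOf_eq_card (P : Fin n → Prop) [DecidablePred P] :
    {i | P i}.ncard = #{i | P i} := by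
  rw [← Set.ncard_coe_finset]
  simp

/-- Openers below `i` exceed earlier `SdE` indices by `h i`, which is larger than `c i - 1`. -/
theorem exists_isUpperCode [NeZero n] {W : Triple n} (hW : IsHistory W) :
    ∃ σ, IsUpperCode W.w (fun i => (W.c i).toNat - 1) σ := by
  have := exists_isRankCode (α := Fin n) (β := Fin n) {i | (W.w i).IsSdE}
    (fun i => {k | k < i ∧ (W.w k).IsOpener}) (fun i => (W.c i).toNat - 1) ?_
  · simpa only [IsUpperCode, coe_filter, mem_univ, true_and] using this
  · intro i hi
    replace hi : (W.w i).IsSdE := by simpa using hi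
    have h1 := ordinate_add_card_isSdE W.w i.val
    have h2 := hW.weight_le i
    have h3 := hW.weight_ge_of_SdE i hi
    rw [hW.height, stepHeight] at h2
    simp only [mem_filter_univ]
    rw [ncard_setOf_eq_card, ncard_setOf_eq_card]
    simp only [← Fin.lt_def, and_comm (a := (_ : Fin n) < i)] at h1 ⊢
    omega

theorem exists_isLowerCode [NeZero n] {W : Triple n} (hW : IsHistory W) :
    ∃ σ, IsLowerCode W.w (fun i => (W.c i).toNat) σ := by
  let B : Finset (Fin n) := {i | (W.w i).IsNE}
  have hB : ∀ i, i ∈ B ↔ (W.w i).IsNE := fun i => mem_filter_univ i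
  have := exists_isRankCode (α := (Fin n)ᵒᵈ) (β := (Fin n)ᵒᵈ) B
    (fun i => {k | ofDual i ≤ ofDual k ∧ ¬ (W.w (ofDual k)).IsOpener})
    (fun i => (W.c (ofDual i)).toNat) ?_
  · obtain ⟨f, hf⟩ := this
    refine ⟨f, ?_⟩
    have hS : (B : Set (Fin n)) = {i | (W.w i).IsNE} := by ext i; simp [hB]
    have key : ∀ S : Set (Fin n), (B : Set (Fin n)) = S →
        IsRankCode (α := (Fin n)ᵒᵈ) (β := (Fin n)ᵒᵈ) S
          (fun i => {k | ofDual i ≤ ofDual k ∧ ¬ (W.w (ofDual k)).IsOpener})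
          (fun i => (W.c (ofDual i)).toNat) f := by
      rintro _ rfl
      exact hf
    exact key _ hS
  · intro i hi
    replace hi : (W.w (ofDual i)).IsNE := (hB i).1 hi
    have h1 := ordinate_add_card_isNE hW.path.2 (ofDual i).val
    have h2 := hW.weight_le (ofDual i)
    have h3 := hW.weight_ge_of_NE (ofDual i) hi
    rw [hW.height, stepHeight] at h2
    change {b' : Fin n | b' ∈ B ∧ ofDual i < b'}.ncard + _ < {k : Fin n | ofDual i ≤ k ∧ ¬ (W.w k).IsOpener}.ncard
    simp only [hB]
    rw [ncard_setOf_eq_card, ncard_setOf_eq_card]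
    -- The count from the right includes `i`, which has not chosen yet; leaving it out provides the
    -- one extra free place that makes `c i ≤ h i` sufficient.
    have h4 := card_filter_split (fun j => (ofDual i).val ≤ j.val ∧ (W.w j).IsNE) (ofDual i)
    rw [if_pos ⟨le_rfl, hi⟩] at h4
    have h5 : #{j : Fin n | ((ofDual i).val ≤ j.val ∧ (W.w j).IsNE) ∧ j ≠ ofDual i} =
        #{j : Fin n | (W.w j).IsNE ∧ ofDual i < j} := by
      congr 1
      ext j
      simp only [mem_filter_univ]
      grind
    simp only [← Fin.le_def] at h1 h4 h5
    omega

theorem fzHistory_surjective [NeZero n] : Function.Surjective (fzHistory (n := n)) := by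
  rintro ⟨W, hW⟩
  obtain ⟨f, hf⟩ := exists_isUpperCode hW
  obtain ⟨g, hg⟩ := exists_isLowerCode hW
  have hfi := IsRankCode.injOn hf
  have hgi := IsRankCode.injOn (α := (Fin n)ᵒᵈ) (β := (Fin n)ᵒᵈ) hg
  have hf' := (isUpperCode_iff _ _ _).1 hf
  have hg' := (isLowerCode_iff _ _ _).1 hg
  have hnot : ∀ {i}, ¬ (W.w i).IsNE → (W.w i).IsSdE := fun h => (Step.isSdE_iff_not_isNE _).2 h
  -- The candidate for `π⁻¹`. The two halves cannot collide, because `f` picks openers and `g`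
  -- non-openers.
  let σ : Fin n → Fin n := fun i => if (W.w i).IsNE then g i else f i
  have hσ1 : ∀ {i}, (W.w i).IsNE → σ i = g i := fun h => if_pos h
  have hσ2 : ∀ {i}, ¬ (W.w i).IsNE → σ i = f i := fun h => if_neg h
  have hσ : Function.Injective σ := by
    intro i j hij
    by_cases hi : (W.w i).IsNE <;> by_cases hj : (W.w j).IsNE
    · rw [hσ1 hi, hσ1 hj] at hij
      exact hgi hi hj hij
    · rw [hσ1 hi, hσ2 hj] at hij
      exact absurd (hij ▸ (hf' j (hnot hj)).1.2) (hg' i hi).1.2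
    · rw [hσ2 hi, hσ1 hj] at hij
      exact absurd (hij ▸ (hf' i (hnot hi)).1.2) (hg' j hj).1.2
    · rw [hσ2 hi, hσ2 hj] at hij
      exact hfi (hnot hi) (hnot hj) hij
  let τ : Equiv.Perm (Fin n) := Equiv.ofBijective σ (Finite.injective_iff_bijective.1 hσ)
  have hτ : ∀ i, (τ⁻¹)⁻¹ i = σ i := fun i => by rw [inv_inv]; rfl
  have hτσ : ∀ i, τ⁻¹ (σ i) = i := fun i => inv_apply_self τ i
  have hSdE : ∀ i, (fzStep τ⁻¹ i).IsSdE ↔ (W.w i).IsSdE := by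
    intro i
    rw [isSdE_fzStep, hτ, Step.isSdE_iff_not_isNE]
    by_cases hi : (W.w i).IsNE
    · rw [hσ1 hi]
      exact iff_of_false (hg' i hi).1.1.not_gt (not_not.2 hi)
    · rw [hσ2 hi]
      exact iff_of_true (hf' i (hnot hi)).1.1 hi
  have hOp : ∀ i, (fzStep τ⁻¹ i).IsOpener ↔ (W.w i).IsOpener := by
    intro k
    -- Every position is chosen by some `i`, whose label decides whether that position is an opener.
    obtain ⟨i, rfl⟩ := τ.surjective k
    change (fzStep τ⁻¹ (σ i)).IsOpener ↔ (W.w (σ i)).IsOpener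
    rw [isOpener_fzStep, IsEp, hτσ]
    by_cases hi : (W.w i).IsNE
    · rw [hσ1 hi]
      exact iff_of_false (hg' i hi).1.1.not_gt (hg' i hi).1.2
    · rw [hσ2 hi]
      exact iff_of_true (hf' i (hnot hi)).1.1 (hf' i (hnot hi)).1.2
  have hw : fzStep τ⁻¹ = W.w := funext fun i => Step.eq_of_iff (hSdE i) (hOp i)
  refine ⟨τ⁻¹, Subtype.ext (Triple.ext hw ?_ ?_)⟩
  · change stepHeight (fzStep τ⁻¹) = W.h
    rw [hw]
    exact (funext hW.height).symm
  · funext i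
    change (sideNumber τ⁻¹ ((τ⁻¹)⁻¹ i) : ℤ) + (if (fzStep τ⁻¹ i).IsSdE then 1 else 0) = W.c i
    have hu := (isUpperCode_iff _ _ _).1 (isUpperCode_inv τ⁻¹)
    have hl := (isLowerCode_iff _ _ _).1 (isLowerCode_inv τ⁻¹)
    simp only [hw, hτ] at hu hl ⊢
    by_cases hi : (W.w i).IsNE
    · have h1 := (hl i hi).2.2
      have h2 := (hg' i hi).2.2
      have h3 := hW.weight_ge_of_NE i hi
      rw [if_neg (by rwa [Step.isSdE_iff_not_isNE, not_not]), add_zero, ← h1]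
      rw [← Int.toNat_of_nonneg h3, ← h2, hσ1 hi]
      congr 3
      ext a
      refine and_congr_right fun _ => and_congr_left fun _ => forall_congr' fun b' =>
        forall_congr' fun hb' => by rw [hσ1 hb']
    · have h1 := (hu i (hnot hi)).2.2
      have h2 := (hf' i (hnot hi)).2.2
      have h3 := hW.weight_ge_of_SdE i (hnot hi)
      rw [if_pos (hnot hi), ← h1]
      have h4 : W.c i = (((W.c i).toNat - 1 : ℕ) : ℤ) + 1 := by omega
      rw [h4, ← h2, hσ2 hi]
      congr 3
      ext a
      refine and_congr_right fun _ => and_congr_left fun _ => forall_congr' fun b' =>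
        forall_congr' fun hb' => by rw [hσ2 ((Step.isSdE_iff_not_isNE _).1 hb')]

/-! ### The map `θ` and the reflection of histories -/

theorem theta_involutive : Function.Involutive (theta (n := n)) := by
  intro π
  -- The dihedral relation: reversal conjugates the rotation to its inverse.
  have key : Fin.revPerm * finRotate n * Fin.revPerm * finRotate n = 1 := by
    ext i
    have : NeZero n := ⟨by have := i.is_lt; omega⟩
    rcases (Nat.succ_le_of_lt i.is_lt).lt_or_eq with h | h
    · have h' : (Fin.rev (⟨i.val + 1, h⟩ : Fin n)).val + 1 < n := by simp [Fin.val_rev]; omega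
      simp only [Equiv.Perm.mul_apply, finRotate_of_val_lt i h, Fin.revPerm_apply,
        finRotate_of_val_lt _ h']
      simp [Fin.val_rev]; omega
    · have h' : (Fin.rev (0 : Fin n)).val + 1 = n := by simp [Fin.val_rev]; omega
      simp only [Equiv.Perm.mul_apply, finRotate_of_val_last i h, Fin.revPerm_apply,
        finRotate_of_val_last _ h']
      simp [Fin.val_rev]; omega
  have hrev : (Fin.revPerm : Equiv.Perm (Fin n)) * Fin.revPerm = 1 := by ext; simp
  calc theta (theta π)
      = (Fin.revPerm * Fin.revPerm) * π *
        (Fin.revPerm * finRotate n * Fin.revPerm * finRotate n) := by simp only [theta, mul_assoc]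
    _ = π := by rw [key, hrev, one_mul, mul_one]

/-- The change of positions that turns `π` into `θ(π)`. -/
def thetaIndex (n : ℕ) : Equiv.Perm (Fin n) := (finRotate n)⁻¹ * Fin.revPerm

theorem val_thetaIndex (k : Fin n) :
    (thetaIndex n k).val = if k.val + 1 = n then n - 1 else n - 2 - k.val := by
  have : NeZero n := ⟨by have := k.is_lt; omega⟩
  have hk := k.is_lt
  rw [thetaIndex, Equiv.Perm.mul_apply, Fin.revPerm_apply]
  split_ifs with h
  · have h1 : (⟨n - 1, by omega⟩ : Fin n).val + 1 = n := by simp; omega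
    rw [(Equiv.Perm.inv_eq_iff_eq (y := ⟨n - 1, by omega⟩)).2]
    rw [finRotate_of_val_last _ h1]
    exact Fin.ext (by simp [Fin.val_rev]; omega)
  · have h1 : (⟨n - 2 - k.val, by omega⟩ : Fin n).val + 1 < n := by simp; omega
    rw [(Equiv.Perm.inv_eq_iff_eq (y := ⟨n - 2 - k.val, by omega⟩)).2]
    rw [finRotate_of_val_lt _ h1]
    exact Fin.ext (by simp [Fin.val_rev]; omega)

theorem theta_thetaIndex (π : Equiv.Perm (Fin n)) (k : Fin n) :
    theta π (thetaIndex n k) = (π k).rev := by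
  simp only [theta, thetaIndex, Equiv.Perm.mul_apply, apply_inv_self, Fin.revPerm_apply,
    Fin.rev_rev]

theorem theta_inv_rev (π : Equiv.Perm (Fin n)) (i : Fin n) :
    (theta π)⁻¹ i.rev = thetaIndex n (π⁻¹ i) := by
  rw [Equiv.Perm.inv_eq_iff_eq, theta_thetaIndex, apply_inv_self]

theorem apply_eq_iff_val (π : Equiv.Perm (Fin n)) (k i : Fin n) :
    (π k).val = i.val ↔ k.val = (π⁻¹ i).val := by
  rw [← Fin.ext_iff, ← Fin.ext_iff, Equiv.Perm.eq_inv_iff_eq]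

section

variable (π : Equiv.Perm (Fin n)) (l i : Fin n)

/-- Away from the last position, `n - 2 - q < n - 1 - i` means `i ≤ q`, where `q` is the position of
`i`; the last position stays last, so its value is never `SdE`. -/
theorem isSdE_fzStep_theta (hl : l.val + 1 = n) :
    (fzStep (theta π) i.rev).IsSdE ↔ i ≠ π l ∧ (fzStep π i).IsNE := by
  have h1 := val_thetaIndex (π⁻¹ i)
  have h2 := apply_eq_iff_val π l i
  rw [isSdE_fzStep, isNE_fzStep, theta_inv_rev, Fin.lt_def, Fin.le_def, h1, Fin.val_rev,
    ne_eq, Fin.ext_iff]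
  have := (π⁻¹ i).is_lt
  have := i.is_lt
  split_ifs <;> omega

/-- Upward arcs of π are matched with downward ones of θ(π). Only the arc of π ending at `i` and the
letter in the last position escape the matching. -/
theorem stepHeight_fzStep_theta (hl : l.val + 1 = n) :
    stepHeight (fzStep (theta π)) i.rev = stepHeight (fzStep π) i
      - (if (fzStep π i).IsSdE then 1 else 0) + (if i < π l then 1 else 0) := by
  rw [stepHeight_fzStep', stepHeight_fzStep]
  simp only [isSdE_fzStep]
  have h0 := card_filter_comp_perm (thetaIndex n) (fun k => theta π k < i.rev ∧ i.rev ≤ k)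
  simp only [theta_thetaIndex] at h0
  rw [← h0, card_filter_split _ l]
  have h1 := card_filter_split (fun j => j < i ∧ i ≤ π j) (π⁻¹ i)
  simp only [apply_inv_self, le_refl, and_true] at h1
  rw [h1]
  have h2 : #{k | ((π k).rev < i.rev ∧ i.rev ≤ thetaIndex n k) ∧ k ≠ l} =
      #{k | (k < i ∧ i ≤ π k) ∧ k ≠ π⁻¹ i} := by
    congr 1
    ext k
    have h3 := val_thetaIndex k
    have h4 := apply_eq_iff_val π k i
    have := i.is_lt
    have := k.is_lt
    have := (π k).is_lt
    simp only [mem_filter_univ]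
    simp only [Fin.lt_def, Fin.le_def, Fin.val_rev, h3, ne_eq, Fin.ext_iff, ← h4]
    split_ifs <;> omega
  rw [h2]
  have h5 : ((π l).rev < i.rev ∧ i.rev ≤ thetaIndex n l) ↔ i < π l := by
    have h3 := val_thetaIndex l
    have := i.is_lt
    simp only [Fin.rev_lt_rev, Fin.le_def, Fin.val_rev, h3, hl, if_true]
    omega
  simp only [h5]
  push_cast
  ring

theorem sideNumber_last (hl : l.val + 1 = n) : sideNumber π l = 0 := by
  have hlk : ∀ k : Fin n, ¬ l < k := fun k => by
    have := k.is_lt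
    rw [Fin.lt_def]
    omega
  rw [sideNumber, if_neg (show ¬ IsEp π l from hlk _), card_eq_zero, filter_eq_empty_iff]
  exact fun k _ h => hlk k h.1

/-- The excedance value `i` becomes a non-excedance value; the last letter, now to its right, adds 1
exactly when its complement is the smaller value. -/
theorem sideNumber_theta_of_lt (hl : l.val + 1 = n) (h : π⁻¹ i < i) :
    sideNumber (theta π) ((theta π)⁻¹ i.rev) =
      sideNumber π (π⁻¹ i) + if i < π l then 1 else 0 := by
  have hi := i.is_lt
  have hpi := (π⁻¹ i).is_lt
  have hq := val_thetaIndex (π⁻¹ i)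
  have hll := val_thetaIndex l
  rw [if_pos hl] at hll
  have h' := Fin.lt_def.1 h
  rw [if_neg (by omega)] at hq
  rw [theta_inv_rev, sideNumber, sideNumber, if_neg, if_pos (by rwa [IsEp, apply_inv_self])]
  · simp only [IsEp, theta_thetaIndex, apply_inv_self]
    have h0 := card_filter_comp_perm (thetaIndex n)
      (fun k => thetaIndex n (π⁻¹ i) < k ∧ ¬ k < theta π k ∧ theta π k < i.rev)
    simp only [theta_thetaIndex] at h0
    rw [← h0, card_filter_split _ l]
    congr 1
    · congr 1
      ext k
      have h3 := val_thetaIndex k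
      have := k.is_lt
      have := (π k).is_lt
      simp only [mem_filter_univ]
      simp only [Fin.lt_def, Fin.val_rev, h3, hq, ne_eq, Fin.ext_iff]
      split_ifs <;> omega
    · congr 1
      have := (π l).is_lt
      simp only [Fin.lt_def, Fin.val_rev, hll, hq, eq_iff_iff]
      omega
  · rw [IsEp, theta_thetaIndex, apply_inv_self, Fin.lt_def, hq, Fin.val_rev]
    omega

theorem sideNumber_theta_of_le (hl : l.val + 1 = n) (h : i ≤ π⁻¹ i) (hil : i ≠ π l) :
    sideNumber π (π⁻¹ i) =
      sideNumber (theta π) ((theta π)⁻¹ i.rev) + if π l < i then 1 else 0 := by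
  have hi := i.is_lt
  have hpi := (π⁻¹ i).is_lt
  have hq := val_thetaIndex (π⁻¹ i)
  have hll := val_thetaIndex l
  rw [if_pos hl] at hll
  have h' := Fin.le_def.1 h
  have hil' := (apply_eq_iff_val π l i).not.1 fun h => hil (Fin.ext h.symm)
  rw [if_neg (by omega)] at hq
  rw [theta_inv_rev, sideNumber, sideNumber, if_neg (by rwa [IsEp, apply_inv_self, not_lt]), if_pos]
  · simp only [IsEp, theta_thetaIndex, apply_inv_self]
    have h0 := card_filter_comp_perm (thetaIndex n)
      (fun k => k < thetaIndex n (π⁻¹ i) ∧ k < theta π k ∧ i.rev < theta π k)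
    simp only [theta_thetaIndex] at h0
    rw [← h0, card_filter_split _ l]
    congr 1
    · congr 1
      ext k
      have h3 := val_thetaIndex k
      have := k.is_lt
      have := (π k).is_lt
      simp only [mem_filter_univ]
      simp only [Fin.lt_def, Fin.val_rev, h3, hq, ne_eq, Fin.ext_iff]
      split_ifs <;> omega
    · congr 1
      have := (π l).is_lt
      simp only [Fin.lt_def, eq_iff_iff]
      omega
  · rw [IsEp, theta_thetaIndex, apply_inv_self, Fin.lt_def, hq, Fin.val_rev]
    omega

/-- The correction is the one in `stepHeight_fzStep_theta`, whence the weight condition of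
`IsReflection`. -/
theorem fzTriple_theta_weight (hl : l.val + 1 = n) :
    (fzTriple (theta π)).c i.rev = (fzTriple π).c i - (if (fzStep π i).IsSdE then 1 else 0) +
      (if i < π l then 1 else 0) := by
  simp only [fzTriple, isSdE_fzStep_theta π l i hl, isNE_fzStep, isSdE_fzStep π]
  by_cases hil : i = π l
  · subst hil
    have hq : (theta π)⁻¹ (π l).rev = l := by
      rw [theta_inv_rev, inv_apply_self, Fin.ext_iff, val_thetaIndex, if_pos hl]
      omega
    simp [-Equiv.Perm.coe_inv, hq, inv_apply_self, sideNumber_last (theta π) l hl, sideNumber_last π l hl]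
  · by_cases h : π⁻¹ i < i
    · rw [sideNumber_theta_of_lt π l i hl h]
      simp [-Equiv.Perm.coe_inv, h, h.not_ge]
    · rw [sideNumber_theta_of_le π l i hl (not_lt.1 h) hil]
      rcases lt_or_gt_of_ne hil with h' | h' <;>
        simp [-Equiv.Perm.coe_inv, h, not_lt.1 h, h', h'.asymm, hil]

theorem fzTriple_weight_last (hl : l.val + 1 = n) : (fzTriple π).c (π l) = 0 := by
  simp only [fzTriple, inv_apply_self, sideNumber_last π l hl, isSdE_fzStep]
  rw [if_neg]
  · simp
  · rw [Fin.lt_def]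
    omega

/-- Either the `SdE` shift contributes 1, or the last letter is a smaller non-excedance value to the
right of `i`. -/
theorem fzTriple_weight_pos (hl : l.val + 1 = n) (h : π l < i) : 0 < (fzTriple π).c i := by
  simp only [fzTriple, isSdE_fzStep]
  by_cases h' : π⁻¹ i < i
  · rw [if_pos h']
    positivity
  · rw [sideNumber_theta_of_le π l i hl (not_lt.1 h') h.ne', if_pos h]
    split_ifs
    positivity

end

theorem cs_fzHistory [NeZero n] (π : Equiv.Perm (Fin n)) (l : Fin n) (hl : l.val + 1 = n) :
    (fzHistory π).cs = π l := by
  refine le_antisymm (Finset.max'_le _ _ _ fun i hi => ?_) (Finset.le_max' _ _ ?_)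
  · by_contra h
    exact (fzTriple_weight_pos π l i hl (not_le.1 h)).ne' (mem_filter.1 hi).2
  · exact mem_filter.2 ⟨mem_univ _, fzTriple_weight_last π l hl⟩

theorem isReflection_fzHistory_theta [NeZero n] (π : Equiv.Perm (Fin n)) :
    IsReflection (fzHistory π) (fzHistory (theta π)) := by
  have hn := NeZero.pos n
  obtain ⟨l, hl⟩ : ∃ l : Fin n, l.val + 1 = n := ⟨⟨n - 1, by omega⟩, by simp; omega⟩
  have hcs := cs_fzHistory π l hl
  have hheight : ∀ j, (fzHistory (theta π)).1.h j = (fzHistory π).1.h j.rev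
      - (if (fzStep π j.rev).IsSdE then 1 else 0) + (if j.rev < π l then 1 else 0) := by
    intro j
    have := stepHeight_fzStep_theta π l j.rev hl
    rwa [Fin.rev_rev] at this
  have hSdE : ∀ j, (fzStep (theta π) j).IsSdE ↔ j.rev ≠ π l ∧ (fzStep π j.rev).IsNE := by
    intro j
    have := isSdE_fzStep_theta π l j.rev hl
    rwa [Fin.rev_rev] at this
  have hNE : ∀ {s : Step}, s.IsNE ↔ ¬ s.IsSdE := by
    intro s
    rw [Step.isSdE_iff_not_isNE, not_not]
  refine ⟨?_, fun j hj => ?_, fun j => ?_, fun j => ?_⟩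
  · rw [hcs, cs_fzHistory _ l hl, theta_last _ _ hl]
  · change (fzStep (theta π) j).IsNE ↔ (fzStep π j.rev).IsSdE
    have hj' : j.rev ≠ π l := by
      rintro h
      exact hj (by rw [hcs, ← h, Fin.rev_rev])
    rw [hNE, hSdE, Step.isSdE_iff_not_isNE]
    tauto
  · rw [hheight, hcs]
    change _ = if (π l).rev < j ∧ (fzStep (theta π) j).IsSdE then _
      else if j < (π l).rev ∧ (fzStep (theta π) j).IsNE then _ else _
    have h1 : (π l).rev < j ↔ j.rev < π l := Fin.rev_lt_iff
    have h2 : j < (π l).rev ↔ π l < j.rev := Fin.lt_rev_iff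
    simp only [h1, h2, hNE, hSdE]
    have h3 : j.rev = π l → ¬ (fzStep π j.rev).IsSdE := by
      rintro h
      rw [isSdE_fzStep, h, inv_apply_self, Fin.lt_def]
      omega
    have h4 := Step.isSdE_iff_not_isNE (fzStep π j.rev)
    -- On either side of the critical index one branch of the height condition survives; at that
    -- index the step of π is `NE` and there is no correction.
    rcases lt_trichotomy j.rev (π l) with h | h | h
    · by_cases hS : (fzStep π j.rev).IsSdE <;> simp [hS, h, h.ne, h.asymm]
    · simp [h, h ▸ h3 h]
    · by_cases hS : (fzStep π j.rev).IsSdE <;> simp [hS, h, h.ne', h.asymm]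
  · rw [hheight]
    have := fzTriple_theta_weight π l j.rev hl
    rw [Fin.rev_rev] at this
    change (fzTriple (theta π)).c j = _ - _ + (fzTriple π).c j.rev
    rw [this]
    ring

/-! ### The Yan–Zhou–Lin map and the Kreweras complement -/

/-- The reversals cancel in pairs, leaving the inverse after the rotation. -/
theorem theta_rci (π : Equiv.Perm (Fin n)) : theta (rci π) = kreweras π := by
  ext i
  simp [theta, rci, reversal, complement, kreweras]

/-- The position of the letter `i` in the Kreweras complement of `π` precedes `π i` cyclically. -/
theorem val_kreweras_inv (π : Equiv.Perm (Fin n)) (i : Fin n) :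
    ((kreweras π)⁻¹ i).val = if (π i).val = 0 then n - 1 else (π i).val - 1 := by
  have : NeZero n := ⟨by have := i.is_lt; omega⟩
  have hi := (π i).is_lt
  split_ifs with h
  · rw [(Equiv.Perm.inv_eq_iff_eq (y := ⟨n - 1, by omega⟩)).2]
    rw [kreweras_last _ _ (by simp; omega)]
    rw [Equiv.Perm.eq_inv_iff_eq, Fin.ext_iff, h]
    rfl
  · rw [(Equiv.Perm.inv_eq_iff_eq (y := ⟨(π i).val - 1, by omega⟩)).2]
    rw [kreweras_of_lt _ _ (by simp; omega), Equiv.Perm.eq_inv_iff_eq, Fin.ext_iff]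
    simp
    omega

theorem apply_val_eq_zero_iff [NeZero n] (π : Equiv.Perm (Fin n)) (i : Fin n) :
    (π i).val = 0 ↔ i = pone π := by
  rw [pone, Equiv.Perm.eq_inv_iff_eq, Fin.ext_iff]
  rfl

theorem isSdE_fzStep_kreweras [NeZero n] (π : Equiv.Perm (Fin n)) (i : Fin n) :
    (fzStep (kreweras π) i).IsSdE ↔ i ≠ pone π ∧ π i ≤ i := by
  have h := apply_val_eq_zero_iff π i
  have := i.is_lt
  rw [isSdE_fzStep, Fin.lt_def, val_kreweras_inv, ne_eq, ← h, Fin.le_def]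
  split_ifs <;> omega

theorem isOpener_fzStep_kreweras_of_lt (π : Equiv.Perm (Fin n)) (i : Fin n) (hi : i.val + 1 < n) :
    (fzStep (kreweras π) i).IsOpener ↔ (⟨i.val + 1, hi⟩ : Fin n) ≤ π⁻¹ ⟨i.val + 1, hi⟩ := by
  rw [isOpener_fzStep, IsEp, kreweras_of_lt _ _ hi]
  rfl

/-- A step is determined by being `SdE`, read from π at `i`, and by being an opener, read from `π⁻¹`
at `i + 1`. The last index is never an opener. -/
theorem yzlStep_eq [NeZero n] (π : Equiv.Perm (Fin n)) : yzlStep π = fzStep (kreweras π) := by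
  funext i
  apply Step.eq_of_iff
  · rw [isSdE_fzStep_kreweras, yzlStep, ← not_lt]
    unfold shiftedStep
    have hlast : ¬ i.val + 1 < n → ¬ i < π i := fun h h' => by
      have := (π i).is_lt
      rw [Fin.lt_def] at h'
      omega
    split_ifs with h1 h2 <;> simp_all [Step.IsSdE, eq_comm]
  · by_cases hi : i.val + 1 < n
    · rw [isOpener_fzStep_kreweras_of_lt _ _ hi, yzlStep, dif_pos hi]
      unfold shiftedStep
      split_ifs <;> simp_all [Step.IsOpener]
    · rw [isOpener_fzStep, yzlStep, dif_neg hi]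
      refine iff_of_false ?_ fun h => ?_
      · split_ifs <;> simp [Step.IsOpener]
      · have := (kreweras π i).is_lt
        rw [IsEp, Fin.lt_def] at h
        omega

/-- The position of 1 is counted in `nest` when it lies beyond `i`, but it wraps to the last place
in the Kreweras complement and drops out of the side number. -/
theorem vnest_eq_of_le [NeZero n] (π : Equiv.Perm (Fin n)) (i : Fin n) (hp : i ≠ pone π)
    (h : π i ≤ i) : vnest π i = sideNumber (kreweras π) ((kreweras π)⁻¹ i) := by
  have h' := Fin.le_def.1 h
  have hi := i.is_lt
  have hq := val_kreweras_inv π i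
  have hi0 := (apply_val_eq_zero_iff π i).not.2 hp
  rw [if_neg hi0] at hq
  have hp0 : (π (pone π)).val = 0 := (apply_val_eq_zero_iff π _).2 rfl
  have hvn : vnest π i = (nest π i : ℤ) - if i < pone π then 1 else 0 := by
    rw [vnest]
    by_cases hip : i < pone π <;> simp [hip, h, h.not_gt]
  rw [hvn, sub_eq_iff_eq_add, sideNumber, if_pos]
  · rw [nest, card_filter_split _ (pone π)]
    have h0 := card_filter_comp_perm (kreweras π)⁻¹
      (fun k => k < (kreweras π)⁻¹ i ∧ k < kreweras π k ∧ i < kreweras π k)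
    simp only [apply_inv_self, IsEp] at h0 ⊢
    rw [← h0]
    push_cast
    congr 1
    · congr 2
      ext k
      have h3 := val_kreweras_inv π k
      have h4 := apply_val_eq_zero_iff π k
      have := k.is_lt
      have := (π k).is_lt
      simp only [mem_filter_univ]
      simp only [Fin.lt_def, Fin.le_def, h3, hq, ne_eq, ← h4] at h ⊢
      split_ifs <;> omega
    · congr 1
      simp only [Fin.lt_def, Fin.le_def, hp0, eq_iff_iff]
      omega
  · rw [IsEp, apply_inv_self, Fin.lt_def, hq]
    omega

/-- Here the wrapped value `pone π` in the last place enters the side number when it is below `i`,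
although `nest` does not count it. -/
theorem vnest_eq_of_lt [NeZero n] (π : Equiv.Perm (Fin n)) (i : Fin n)
    (h : i < π i) : vnest π i = sideNumber (kreweras π) ((kreweras π)⁻¹ i) := by
  have h' := Fin.lt_def.1 h
  have hi := (π i).is_lt
  have hq := val_kreweras_inv π i
  rw [if_neg (by omega)] at hq
  have hp0 : (π (pone π)).val = 0 := (apply_val_eq_zero_iff π _).2 rfl
  have hq0 := val_kreweras_inv π (pone π)
  rw [if_pos hp0] at hq0
  have hpn := (pone π).is_lt
  have hvn : vnest π i = (nest π i : ℤ) + if pone π < i then 1 else 0 := by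
    rw [vnest]
    by_cases hip : pone π < i <;> simp [hip, h, h.not_ge]
  rw [sideNumber, if_neg, hvn]
  · have h0 := card_filter_comp_perm (kreweras π)⁻¹
      (fun k => (kreweras π)⁻¹ i < k ∧ ¬ k < kreweras π k ∧ kreweras π k < i)
    simp only [apply_inv_self, IsEp] at h0 ⊢
    rw [← h0, nest, card_filter_split (fun k => (kreweras π)⁻¹ i < _ ∧ _) (pone π)]
    push_cast
    congr 1
    · congr 2
      ext k
      have h3 := val_kreweras_inv π k
      have h4 := apply_val_eq_zero_iff π k
      have := k.is_lt
      have := (π k).is_lt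
      simp only [mem_filter_univ]
      simp only [Fin.lt_def, Fin.le_def, h3, hq, ne_eq, ← h4] at h ⊢
      split_ifs <;> omega
    · congr 1
      simp only [Fin.lt_def, hq, hq0, eq_iff_iff]
      omega
  · rw [IsEp, apply_inv_self, Fin.lt_def, hq]
    omega

theorem vnest_pone [NeZero n] (π : Equiv.Perm (Fin n)) :
    vnest π (pone π) = sideNumber (kreweras π) ((kreweras π)⁻¹ (pone π)) := by
  have hp0 : (π (pone π)).val = 0 := (apply_val_eq_zero_iff π _).2 rfl
  have hq0 := val_kreweras_inv π (pone π)
  rw [if_pos hp0] at hq0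
  rw [vnest, if_neg fun h => h.2.false, if_neg fun h => h.2.false, sideNumber, if_neg, nest]
  · congr 1
    rw [card_eq_zero.2, card_eq_zero.2]
    · rw [filter_eq_empty_iff]
      rintro k - ⟨h, -⟩
      have := k.is_lt
      rw [Fin.lt_def] at h
      omega
    · rw [filter_eq_empty_iff]
      intro k _ h
      simp only [Fin.lt_def, Fin.le_def] at h
      omega
  · rw [IsEp, apply_inv_self, Fin.lt_def, hq0]
    have := (pone π).is_lt
    omega

theorem yzlTriple_eq [NeZero n] (π : Equiv.Perm (Fin n)) : yzlTriple π = fzTriple (kreweras π) := by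
  have hv : ∀ i, vnest π i = sideNumber (kreweras π) ((kreweras π)⁻¹ i) := by
    intro i
    rcases lt_or_ge i (π i) with h | h
    · exact vnest_eq_of_lt π i h
    · by_cases hp : i = pone π
      · exact hp ▸ vnest_pone π
      · exact vnest_eq_of_le π i hp h
  simp only [yzlTriple, fzTriple, yzlStep_eq, hv]

/-! ### Uniqueness of the reflection -/

theorem History.weight_cs [NeZero n] (W : History n) : W.1.c W.cs = 0 :=
  (mem_filter.1 (Finset.max'_mem (univ.filter fun i : Fin n => W.1.c i = 0) _)).2

theorem isNE_of_weight_eq_zero {W : Triple n} (hW : IsHistory W) {i : Fin n} (h : W.c i = 0) :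
    (W.w i).IsNE := by
  by_contra hNE
  have := hW.weight_ge_of_SdE i ((Step.isSdE_iff_not_isNE _).2 hNE)
  omega

/-- Consecutive ordinates separate `N`, `S` and east steps, and the label separates the two kinds of
east steps; the final ordinate 0 settles the last step. -/
theorem steps_ext {v v' : Fin n → Step} (hv : ordinate v n = 0) (hv' : ordinate v' n = 0)
    (hh : ∀ i, stepHeight v i = stepHeight v' i) (hNE : ∀ i, (v i).IsNE ↔ (v' i).IsNE) :
    v = v' := by
  funext i
  have h1 : ordinate v (i.val + 1) = ordinate v' (i.val + 1) := by
    rcases (Nat.succ_le_of_lt i.is_lt).lt_or_eq with h | h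
    · exact hh ⟨i.val + 1, h⟩
    · rw [show i.val + 1 = n from h, hv, hv']
  have h2 : ordinate v i.val = ordinate v' i.val := hh i
  rw [ordinate_succ, ordinate_succ, h2] at h1
  have h3 := hNE i
  cases hs : v i <;> cases hs' : v' i <;> simp [hs, hs', Step.IsNE] at h1 h3 ⊢
  omega

theorem IsReflection.unique [NeZero n] {W V V' : History n} (h : IsReflection W V)
    (h' : IsReflection W V') : V = V' := by
  have hNE : ∀ j, (V.1.w j).IsNE ↔ (V'.1.w j).IsNE := by
    intro j
    by_cases hj : j = W.cs.rev
    · refine iff_of_true (isNE_of_weight_eq_zero V.2 ?_) (isNE_of_weight_eq_zero V'.2 ?_)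
      · rw [hj, ← h.critical, V.weight_cs]
      · rw [hj, ← h'.critical, V'.weight_cs]
    · rw [h.step j hj, h'.step j hj]
  have hh : ∀ j, V.1.h j = V'.1.h j := by
    intro j
    rw [h.height, h'.height]
    simp only [Step.isSdE_iff_not_isNE, hNE]
  refine Subtype.ext (Triple.ext ?_ (funext hh) (funext fun j => ?_))
  · refine steps_ext V.2.path.2 V'.2.path.2 (fun i => ?_) hNE
    rw [← V.2.height, ← V'.2.height, hh]
  · rw [h.weight, h'.weight, hh]

/-- The bijection `Φ_FZ` from permutations to histories. -/
noncomputable def fzEquiv (n : ℕ) [NeZero n] : Equiv.Perm (Fin n) ≃ History n :=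
  Equiv.ofBijective fzHistory ⟨fzHistory_injective, fzHistory_surjective⟩

/-- The involution `ξ` on histories, transported from the involution `θ` on permutations. -/
noncomputable def xi (n : ℕ) [NeZero n] (W : History n) : History n :=
  fzEquiv n (theta ((fzEquiv n).symm W))

theorem isXi_xi (n : ℕ) [NeZero n] : IsXi (xi n) := by
  refine ⟨fun W => ?_, fun W => ?_⟩
  · simp [xi, theta_involutive _]
  · obtain ⟨π, rfl⟩ := (fzEquiv n).surjective W
    rw [xi, Equiv.symm_apply_apply]
    exact isReflection_fzHistory_theta π

end SRLaguerre

theorem theorem4p15 (n : ℕ) [NeZero n] :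
    ∃ (ΦFZ : Equiv.Perm (Fin n) ≃ SRLaguerre.History n)
      (ΦYZL : Equiv.Perm (Fin n) → SRLaguerre.History n)
      (ξ : SRLaguerre.History n → SRLaguerre.History n),
      (∀ π, (ΦFZ π).1 = SRLaguerre.fzTriple π) ∧
      (∀ π, (ΦYZL π).1 = SRLaguerre.yzlTriple π) ∧
      (SRLaguerre.IsXi ξ ∧ ∀ ξ', SRLaguerre.IsXi ξ' → ξ' = ξ) ∧
      (∀ π, ΦFZ.symm (ξ (ΦFZ π)) = SRLaguerre.theta π) ∧
      (∀ π, ΦYZL π = ΦFZ (SRLaguerre.theta (SRLaguerre.rci π)) ∧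
        ΦFZ (SRLaguerre.theta (SRLaguerre.rci π)) = ΦFZ (SRLaguerre.kreweras π)) := by
  -- Taking Φ_YZL to be Φ_FZ after the Kreweras complement makes its values histories at once;
  -- `yzlTriple_eq` identifies their triples.
  refine ⟨SRLaguerre.fzEquiv n, fun π => SRLaguerre.fzHistory (SRLaguerre.kreweras π),
    SRLaguerre.xi n, fun π => rfl, fun π => (SRLaguerre.yzlTriple_eq π).symm,
    ⟨SRLaguerre.isXi_xi n, fun ξ' h => funext fun W => ?_⟩, fun π => ?_, fun π => ?_⟩
  · exact (h.2 W).unique ((SRLaguerre.isXi_xi n).2 W)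
  · simp [SRLaguerre.xi]
  · rw [SRLaguerre.theta_rci]
    exact ⟨rfl, rfl⟩
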